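/- Let $r,s>0$ and $p\in(0,1)$ be constants. Let $X\sim\mathrm{Binomial}(n,p)$ and $Y\sim\mathrm{Binomial}(m,p)$ be independent, and define $$R=\frac{X^s}{(X+Y)^r}$$ (with $R=0$ when $X=Y=0$). Then, as $n,m\to\infty$ (along any sequence of pairs $(n,m)$ with $n\to\infty$ and $m\to\infty$), the following convergences in distribution hold, where $\mathcal N(0,\sigma^2)$ denotes the Normal distribution with mean $0$ and variance $\sigma^2$, and $\mathcal N(0,0)$ is the point mass at $0$: (i) If $m/n\to\infty$ and $m\log(m)\,n^{-3/2}\to0$, then $$\frac{m^r}{n^{s-1/2}}\left(R-\frac{n^s}{(n+m)^r}p^{s-r}\right)\to\mathcal N\left(0,\;p^{2(s-r)-1}(1-p)s^2\right).$$ (ii) If $m/n\to\alpha\in(0,+\infty)$, then $$n^{r-s+1/2}\left(R-\frac{n^s}{(n+m)^r}p^{s-r}\right)\to\mathcal N\left(0,\;p^{2(s-r)-1}(1-p)\frac{(s(1+\alpha)-r)^2+\alpha r^2}{(1+\alpha)^{2(r+1)}}\right).$$ (iii) If $m/n\to0$, then $$n^{r-s+1/2}\left(R-\frac{n^s}{(n+m)^r}p^{s-r}\right)\to\mathcal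 N\left(0,\;p^{2(s-r)-1}(1-p)(s-r)^2\right).$$ -/

import Mathlib

open MeasureTheory ProbabilityTheory Filter Topology

/-- The ratio `R = x ^ s / (x + y) ^ r`, with real exponents. (It takes the value `0` at
`x = y = 0` when `r, s > 0`.) -/
noncomputable def binomRatio (r s : ℝ) (x y : ℕ) : ℝ :=
  (x : ℝ) ^ s / ((x : ℝ) + (y : ℝ)) ^ r

/-- The centring `n ^ s / (n + m) ^ r * p ^ (s - r)`. -/
noncomputable def binomRatioCentre (r s p : ℝ) (n m : ℕ) : ℝ :=
  (n : ℝ) ^ s / ((n : ℝ) + (m : ℝ)) ^ r * p ^ (s - r)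

/-! This is the delta method applied to relative deviations. Put `U = (X - np)/√n`, `V = (Y -
mp)/√m` and `f(a, b) = a^s / b^r`. Then `R` divided by its centring is `f` at `(X/(np),
(X+Y)/((n+m)p))`, a random point near `(1, 1)` (`binomRatio_eq_centre_mul`). Its deviation from `(1,
1)`, multiplied by `p√n`, is `(U, qU + wV)` with `q = n/(n+m)` and `w = √(nm)/(n+m)`. The gradient
of `f` at `(1, 1)` is `(s, -r)`, so the normalized error is a convergent scalar times `(s - rq)U -
rwV`, up to a term vanishing in probability.

If `q → θ` then `w² → θ(1-θ)`. Since `U` and `V` are independent and asymptotically `N(0, p(1-p))`,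
Slutsky's theorem gives a normal limit with variance proportional to `(s - rθ)² + r²θ(1-θ)`. The
three regimes are `θ = 0`, `θ = 1/(1+α)` and `θ = 1`. -/

/-- A sequence of real random variables is bounded in probability. -/
def BoundedInProbability {Ω : Type*} [MeasurableSpace Ω] (μ : Measure Ω) (U : ℕ → Ω → ℝ) : Prop :=
  ∀ ε : ℝ, 0 < ε → ∃ M : ℝ, 0 < M ∧ ∀ᶠ k in atTop, μ.real {ω | M ≤ |U k ω|} ≤ ε

/-! ### Boundedness and convergence in probability -/

section BoundedInProbability

variable {Ω : Type*} [MeasurableSpace Ω] {μ : Measure Ω}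

/-- Chebyshev's inequality; `K + 1` in place of `K` keeps the threshold positive when `K = 0`. -/
lemma BoundedInProbability.of_sq_integral_le {U : ℕ → Ω → ℝ} {K : ℝ}
    (hint : ∀ k, Integrable (fun ω => U k ω ^ 2) μ) (hK : ∀ k, ∫ ω, U k ω ^ 2 ∂μ ≤ K) :
    BoundedInProbability μ U := by
  intro ε hε
  have hK0 : 0 ≤ K := (integral_nonneg fun ω => sq_nonneg (U 0 ω)).trans (hK 0)
  refine ⟨√((K + 1) / ε), Real.sqrt_pos.2 (by positivity), Eventually.of_forall fun k => ?_⟩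
  have hpos : 0 < (K + 1) / ε := by positivity
  have h := mul_meas_ge_le_integral_of_nonneg (μ := μ)
    (ae_of_all _ fun ω => sq_nonneg (U k ω)) (hint k) ((K + 1) / ε)
  have hset : {ω | √((K + 1) / ε) ≤ |U k ω|} = {ω | (K + 1) / ε ≤ U k ω ^ 2} := by
    ext ω
    simp only [Set.mem_ofPred_eq]
    rw [Real.sqrt_le_left (abs_nonneg _), sq_abs]
  rw [hset]
  by_contra! hlt
  have h1 : (K + 1) / ε * ε < (K + 1) / ε * μ.real {ω | (K + 1) / ε ≤ U k ω ^ 2} :=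
    mul_lt_mul_of_pos_left hlt hpos
  rw [div_mul_cancel₀ _ hε.ne'] at h1
  linarith [hK k]

variable [IsProbabilityMeasure μ]

lemma tendstoInMeasure_zero_of_eventually_measureReal_le {W : ℕ → Ω → ℝ}
    (h : ∀ ε > 0, ∀ δ > 0, ∀ᶠ k in atTop, μ.real {ω | ε ≤ |W k ω|} ≤ δ) :
    TendstoInMeasure μ W atTop 0 := by
  rw [tendstoInMeasure_iff_measureReal_norm]
  intro ε hε
  rw [Metric.tendsto_nhds]
  intro δ hδ
  filter_upwards [h ε hε (δ / 2) (by positivity)] with k hk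
  simp only [Pi.zero_apply, sub_zero, Real.norm_eq_abs, Real.dist_eq]
  rw [abs_of_nonneg measureReal_nonneg]
  linarith

lemma BoundedInProbability.abs_add_abs {U V : ℕ → Ω → ℝ} (hU : BoundedInProbability μ U)
    (hV : BoundedInProbability μ V) : BoundedInProbability μ fun k ω => |U k ω| + |V k ω| := by
  intro ε hε
  obtain ⟨M, hM, hM'⟩ := hU (ε / 2) (by positivity)
  obtain ⟨N, hN, hN'⟩ := hV (ε / 2) (by positivity)
  refine ⟨M + N, by positivity, ?_⟩
  filter_upwards [hM', hN'] with k h1 h2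
  have hsub : {ω | M + N ≤ |(|U k ω| + |V k ω|)|} ⊆ {ω | M ≤ |U k ω|} ∪ {ω | N ≤ |V k ω|} := by
    intro ω hω
    simp only [Set.mem_ofPred_eq, Set.mem_union] at hω ⊢
    rw [abs_of_nonneg (by positivity)] at hω
    by_contra! hcon
    linarith [hcon.1, hcon.2]
  calc _ ≤ μ.real ({ω | M ≤ |U k ω|} ∪ {ω | N ≤ |V k ω|}) := measureReal_mono hsub
    _ ≤ _ := measureReal_union_le _ _
    _ ≤ ε := by linarith

/-- The rule `o(1) · O_P(1) = o_P(1)`, which later allows varying coefficients to be replaced by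
their limits. -/
lemma BoundedInProbability.tendstoInMeasure_zero {U W : ℕ → Ω → ℝ} {c : ℕ → ℝ}
    (hU : BoundedInProbability μ U) (hc : Tendsto c atTop (𝓝 0))
    (hW : ∀ᶠ k in atTop, ∀ ω, |W k ω| ≤ |c k| * |U k ω|) : TendstoInMeasure μ W atTop 0 := by
  refine tendstoInMeasure_zero_of_eventually_measureReal_le fun ε hε δ hδ => ?_
  obtain ⟨M, hM, hM'⟩ := hU δ hδ
  have hc' : ∀ᶠ k in atTop, |c k| < ε / M := by
    have := hc.abs
    rw [abs_zero] at this
    exact this.eventually_lt_const (by positivity)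
  filter_upwards [hM', hW, hc'] with k h1 h2 h3
  refine (measureReal_mono fun ω hω => ?_).trans h1
  simp only [Set.mem_ofPred_eq] at hω ⊢
  by_contra! hlt
  have h4 : |c k| * |U k ω| ≤ |c k| * M := mul_le_mul_of_nonneg_left hlt.le (abs_nonneg _)
  have h5 : |c k| * M < ε := (lt_div_iff₀ hM).1 h3
  linarith [h2 ω]

lemma tendstoInMeasure_zero_add {V W : ℕ → Ω → ℝ} (hV : TendstoInMeasure μ V atTop 0)
    (hW : TendstoInMeasure μ W atTop 0) :
    TendstoInMeasure μ (fun k ω => V k ω + W k ω) atTop 0 := by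
  rw [tendstoInMeasure_iff_measureReal_norm] at hV hW
  refine tendstoInMeasure_zero_of_eventually_measureReal_le fun ε hε δ hδ => ?_
  filter_upwards [(hV (ε / 2) (by positivity)).eventually_lt_const (half_pos hδ),
    (hW (ε / 2) (by positivity)).eventually_lt_const (half_pos hδ)] with k h1 h2
  simp only [Pi.zero_apply, sub_zero, Real.norm_eq_abs] at h1 h2
  have hsub : {ω | ε ≤ |V k ω + W k ω|} ⊆ {ω | ε / 2 ≤ |V k ω|} ∪ {ω | ε / 2 ≤ |W k ω|} := by
    intro ω hω
    simp only [Set.mem_ofPred_eq, Set.mem_union] at hω ⊢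
    by_contra! hcon
    linarith [hcon.1, hcon.2, abs_add_le (V k ω) (W k ω)]
  calc _ ≤ μ.real ({ω | ε / 2 ≤ |V k ω|} ∪ {ω | ε / 2 ≤ |W k ω|}) := measureReal_mono hsub
    _ ≤ _ := measureReal_union_le _ _
    _ ≤ δ := by linarith

/-- The remainder estimate of the delta method. -/
lemma BoundedInProbability.tendstoInMeasure_linearization_error {E : Type*} [NormedAddCommGroup E]
    [NormedSpace ℝ E] {f : E → ℝ} {f' : E →L[ℝ] ℝ} {x : E} (hf : HasFDerivAt f f' x)
    {ρ : ℕ → ℝ} (hρ : Tendsto ρ atTop atTop) {v : ℕ → Ω → E} {T : ℕ → Ω → ℝ}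
    (hT : BoundedInProbability μ T) (hv : ∀ᶠ k in atTop, ∀ ω, ρ k * ‖v k ω‖ ≤ |T k ω|) :
    TendstoInMeasure μ (fun k ω => ρ k * (f (x + v k ω) - f x - f' (v k ω))) atTop 0 := by
  refine tendstoInMeasure_zero_of_eventually_measureReal_le fun ε hε δ hδ => ?_
  obtain ⟨M, hM, hM'⟩ := hT δ hδ
  have ho := hasFDerivAt_iff_isLittleO_nhds_zero.1 hf
  -- Where `|T| < M`, the slope `ε / (2M)` keeps the scaled error at most `ε / 2`, and `ρ > M / d`
  -- forces `‖v‖ < d`.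
  obtain ⟨d, hd, hd'⟩ := Metric.eventually_nhds_iff.1 (ho.def (show 0 < ε / (2 * M) by positivity))
  filter_upwards [hM', hv, hρ.eventually_gt_atTop 0, hρ.eventually_gt_atTop (M / d)]
    with k h1 h2 h3 h4
  refine (measureReal_mono fun ω hω => ?_).trans h1
  simp only [Set.mem_ofPred_eq] at hω ⊢
  by_contra! hlt
  have h5 : ρ k * ‖v k ω‖ < M := (h2 ω).trans_lt hlt
  have h6 : ‖v k ω‖ < d := by
    have : M < ρ k * d := (div_lt_iff₀ hd).1 h4
    exact lt_of_mul_lt_mul_left (h5.trans this) h3.le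
  have h7 := hd' (y := v k ω) (by simpa using h6)
  rw [Real.norm_eq_abs] at h7
  rw [abs_mul, abs_of_pos h3] at hω
  have h8 : ρ k * |f (x + v k ω) - f x - f' (v k ω)| ≤ ε / (2 * M) * M := by
    calc _ ≤ ρ k * (ε / (2 * M) * ‖v k ω‖) := mul_le_mul_of_nonneg_left h7 h3.le
      _ = ε / (2 * M) * (ρ k * ‖v k ω‖) := by ring
      _ ≤ _ := mul_le_mul_of_nonneg_left h5.le (by positivity)
  have h9 : ε / (2 * M) * M = ε / 2 := by field_simp
  linarith

end BoundedInProbability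

/-! ### Binomial variance and the central limit theorem -/

section Binomial

open scoped unitInterval

lemma integral_binomial_sub_mul_sq (n : ℕ) (p : I) :
    ∫ x : ℕ, ((x : ℝ) - n * p) ^ 2 ∂(binomial n p) = n * p * (1 - p) := by
  rw [integral_binomial]
  have h := congrArg (Polynomial.eval (p : ℝ)) (bernsteinPolynomial.variance ℝ n)
  simp only [Polynomial.eval_finsetSum, bernsteinPolynomial, nsmul_eq_mul, Polynomial.eval_mul,
    Polynomial.eval_pow, Polynomial.eval_sub, Polynomial.eval_natCast, Polynomial.eval_X,
    Polynomial.eval_one] at h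
  rw [← h, ← Nat.range_succ_eq_Iic]
  refine Finset.sum_congr rfl fun k _ => ?_
  rw [smul_eq_mul]
  ring

/-- The binomial theorem expands the `n`-th power of the centred Bernoulli characteristic function,
so no family of independent trials has to be constructed. -/
lemma charFun_map_binomial_affine (n : ℕ) (p : I) (d t : ℝ) :
    charFun ((binomial n p).map fun x : ℕ => d * ((x : ℝ) - n * p)) t =
      charFun ((binomial 1 p).map fun x : ℕ => (x : ℝ) - p) (d * t) ^ n := by
  rw [charFun_apply_real, charFun_apply_real, integral_map .of_discrete (by fun_prop),
    integral_map .of_discrete (by fun_prop), integral_binomial, integral_binomial]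
  have h1 : ∑ k ∈ Finset.Iic 1, (((1 : ℕ).choose k : ℝ) * (p : ℝ) ^ k * (1 - p) ^ (1 - k)) •
      Complex.exp ((d * t : ℝ) * (((k : ℝ) - p : ℝ) : ℂ) * Complex.I) =
      (p : ℂ) * Complex.exp (d * t * (1 - p) * Complex.I) +
        (1 - p) * Complex.exp (- (d * t * p) * Complex.I) := by
    rw [← Nat.range_succ_eq_Iic, Finset.sum_range_succ, Finset.sum_range_one]
    simp
    ring_nf
  rw [h1, add_pow, ← Nat.range_succ_eq_Iic]
  refine Finset.sum_congr rfl fun k hk => ?_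
  have hk' : k ≤ n := Nat.lt_succ_iff.1 (Finset.mem_range.1 hk)
  rw [mul_pow, mul_pow, ← Complex.exp_nat_mul, ← Complex.exp_nat_mul]
  have h2 : Complex.exp (t * ((d * ((k : ℝ) - n * p) : ℝ) : ℂ) * Complex.I) =
      Complex.exp (k * (d * t * (1 - p) * Complex.I)) *
        Complex.exp ((n - k : ℕ) * (- (d * t * p) * Complex.I)) := by
    rw [← Complex.exp_add]
    congr 1
    push_cast [hk']
    ring
  rw [h2, Complex.real_smul]
  push_cast
  ring

/-- The de Moivre–Laplace theorem in terms of characteristic functions. -/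
lemma tendsto_charFun_binomial_standardized (p : I) (hp0 : 0 < (p : ℝ)) (hp1 : (p : ℝ) < 1)
    (t : ℝ) :
    Tendsto (fun n : ℕ =>
      charFun ((binomial n p).map fun x : ℕ => (√n)⁻¹ * ((x : ℝ) - n * p)) t) atTop
      (𝓝 (Complex.exp (-(p * (1 - p) * t ^ 2) / 2))) := by
  set τ : ℝ := √(p * (1 - p)) with hτ
  have hpq : 0 < (p : ℝ) * (1 - p) := mul_pos hp0 (by linarith)
  have hτ0 : 0 < τ := Real.sqrt_pos.2 hpq
  have hτ2 : τ ^ 2 = p * (1 - p) := Real.sq_sqrt hpq.le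
  have hmean : ∫ x : ℕ, τ⁻¹ * ((x : ℝ) - p) ∂(binomial 1 p) = 0 := by
    rw [integral_binomial, ← Nat.range_succ_eq_Iic, Finset.sum_range_succ, Finset.sum_range_one]
    simp
    ring
  have hvar : ∫ x : ℕ, ((fun x : ℕ => τ⁻¹ * ((x : ℝ) - p)) ^ 2) x ∂(binomial 1 p) = 1 := by
    have h := integral_binomial_sub_mul_sq 1 p
    simp only [Nat.cast_one, one_mul] at h
    simp only [Pi.pow_apply, mul_pow]
    rw [integral_const_mul, h, inv_pow, hτ2, inv_mul_cancel₀ hpq.ne']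
  -- The central limit theorem needs unit variance: divide by `τ` and compensate by evaluating at `τ
  -- * t`.
  have h := tendsto_charFun_inv_sqrt_mul_pow (P := binomial 1 p)
    (X := fun x : ℕ => τ⁻¹ * ((x : ℝ) - p)) .of_discrete hmean hvar (τ * t)
  have hexp : (-((τ * t : ℝ) : ℂ) ^ 2 / 2) = -(p * (1 - p) * t ^ 2) / 2 := by
    have : ((τ : ℂ)) ^ 2 = p * (1 - p) := by exact_mod_cast hτ2
    push_cast
    rw [mul_pow, this]
  rw [hexp] at h
  refine h.congr fun n => ?_
  rw [charFun_map_binomial_affine, charFun_map_mul_comp .of_discrete]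
  congr 2
  field_simp

end Binomial

lemma tendstoInMeasure_zero_mul_of_tendsto {Ω : Type*} [MeasurableSpace Ω] {μ : Measure Ω}
    [IsProbabilityMeasure μ] {W : ℕ → Ω → ℝ} {c : ℕ → ℝ} {c₀ : ℝ} (hc : Tendsto c atTop (𝓝 c₀))
    (hW : TendstoInMeasure μ W atTop 0) :
    TendstoInMeasure μ (fun k ω => c k * W k ω) atTop 0 := by
  rw [tendstoInMeasure_iff_measureReal_norm] at hW
  refine tendstoInMeasure_zero_of_eventually_measureReal_le fun ε hε δ hδ => ?_
  filter_upwards [(hW (ε / (|c₀| + 1)) (by positivity)).eventually_lt_const hδ,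
    hc.abs.eventually_lt_const (lt_add_one |c₀|)] with k h1 h2
  simp only [Pi.zero_apply, sub_zero, Real.norm_eq_abs] at h1
  refine (measureReal_mono fun ω hω => ?_).trans h1.le
  simp only [Set.mem_ofPred_eq] at hω ⊢
  rw [abs_mul] at hω
  rw [div_le_iff₀ (by positivity), mul_comm]
  exact hω.trans (mul_le_mul_of_nonneg_right h2.le (abs_nonneg _))

/-- Convergence in distribution may be checked after realizing all variables on the product of
the underlying probability spaces. -/
lemma tendstoInDistribution_of_comp_eval {Ω : ℕ → Type*} [mΩ : ∀ k, MeasurableSpace (Ω k)]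
    {P : (k : ℕ) → Measure (Ω k)} [∀ k, IsProbabilityMeasure (P k)] {ν : Measure ℝ}
    [IsProbabilityMeasure ν] {Z : (k : ℕ) → Ω k → ℝ} (hZ : ∀ k, AEMeasurable (Z k) (P k))
    (h : TendstoInDistribution (fun k (ω : (j : ℕ) → Ω j) => Z k (ω k)) atTop (id : ℝ → ℝ)
      (fun _ => Measure.infinitePi P) ν) :
    TendstoInDistribution Z atTop (id : ℝ → ℝ) P ν where
  forall_aemeasurable := hZ
  tendsto := by
    refine h.tendsto.congr fun k => Subtype.ext ?_
    have hmp := measurePreserving_eval_infinitePi P k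
    change (Measure.infinitePi P).map (Z k ∘ Function.eval k) = (P k).map (Z k)
    rw [← AEMeasurable.map_map_of_aemeasurable (by rw [hmp.map_eq]; exact hZ k) hmp.aemeasurable,
      hmp.map_eq]

/-! ### Joint normal limit on one probability space -/

section CommonSpace

open scoped unitInterval

variable {Ω : Type*} [MeasurableSpace Ω] {P : Measure Ω}

lemma charFun_map_affine_of_hasLaw_binomial {X : Ω → ℕ} {n : ℕ} {p : I}
    (hX : HasLaw X (binomial n p) P) (d t : ℝ) :
    charFun (P.map fun ω => d * ((X ω : ℝ) - n * p)) t =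
      charFun ((binomial n p).map fun x : ℕ => d * ((x : ℝ) - n * p)) t := by
  rw [← hX.map_eq, AEMeasurable.map_map_of_aemeasurable .of_discrete hX.aemeasurable]
  rfl

lemma boundedInProbability_binomial_standardized {n : ℕ → ℕ} {p : I} {X : ℕ → Ω → ℕ}
    (hX : ∀ k, HasLaw (X k) (binomial (n k) p) P) :
    BoundedInProbability P fun k ω => (√(n k))⁻¹ * ((X k ω : ℝ) - n k * p) := by
  have hcomp (k : ℕ) : (fun ω => ((√(n k : ℝ))⁻¹ * ((X k ω : ℝ) - n k * p)) ^ 2) =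
      (fun x : ℕ => ((√(n k : ℝ))⁻¹ * ((x : ℝ) - n k * p)) ^ 2) ∘ X k := rfl
  have hint (k : ℕ) : Integrable (fun x : ℕ => ((√(n k : ℝ))⁻¹ * ((x : ℝ) - n k * p)) ^ 2)
      ((P.map (X k))) := by
    rw [(hX k).map_eq]
    exact integrable_binomial _
  refine .of_sq_integral_le (K := p * (1 - p)) (fun k => ?_) fun k => ?_
  · rw [hcomp]
    exact (hint k).comp_aemeasurable (hX k).aemeasurable
  · rw [hcomp, (hX k).integral_comp .of_discrete]
    simp only [mul_pow]
    rw [integral_const_mul, integral_binomial_sub_mul_sq, inv_pow, Real.sq_sqrt (Nat.cast_nonneg _)]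
    rcases Nat.eq_zero_or_pos (n k) with h | h
    · simp only [h, Nat.cast_zero, inv_zero, zero_mul]
      exact mul_nonneg p.2.1 (by linarith [p.2.2])
    · have : (0 : ℝ) < n k := by exact_mod_cast h
      apply le_of_eq
      field_simp

variable [IsProbabilityMeasure P]

/-- Lévy's continuity theorem: independence factors the characteristic function, and each factor
converges separately, whatever the relative growth of `n` and `m`. -/
lemma tendstoInDistribution_linear_combination_binomial {n m : ℕ → ℕ}
    (hn : Tendsto n atTop atTop) (hm : Tendsto m atTop atTop) {p : I}
    (hp0 : 0 < (p : ℝ)) (hp1 : (p : ℝ) < 1) {X Y : ℕ → Ω → ℕ}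
    (hX : ∀ k, HasLaw (X k) (binomial (n k) p) P) (hY : ∀ k, HasLaw (Y k) (binomial (m k) p) P)
    (hXY : ∀ k, IndepFun (X k) (Y k) P) (a b : ℝ) :
    TendstoInDistribution (fun k ω => a * ((√(n k))⁻¹ * ((X k ω : ℝ) - n k * p)) +
        b * ((√(m k))⁻¹ * ((Y k ω : ℝ) - m k * p))) atTop (id : ℝ → ℝ) (fun _ => P)
      (gaussianReal 0 (Real.toNNReal (p * (1 - p) * (a ^ 2 + b ^ 2)))) := by
  have hXm (k : ℕ) : AEMeasurable (fun ω => (√(n k : ℝ))⁻¹ * ((X k ω : ℝ) - n k * p)) P :=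
    (Measurable.of_discrete (f := fun x : ℕ => (√(n k : ℝ))⁻¹ * ((x : ℝ) - n k * p))
      ).comp_aemeasurable (hX k).aemeasurable
  have hYm (k : ℕ) : AEMeasurable (fun ω => (√(m k : ℝ))⁻¹ * ((Y k ω : ℝ) - m k * p)) P :=
    (Measurable.of_discrete (f := fun x : ℕ => (√(m k : ℝ))⁻¹ * ((x : ℝ) - m k * p))
      ).comp_aemeasurable (hY k).aemeasurable
  refine ⟨fun k => ((hXm k).const_mul a).add ((hYm k).const_mul b), aemeasurable_id, ?_⟩
  refine ProbabilityMeasure.tendsto_iff_tendsto_charFun.2 fun t => ?_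
  have hind (k : ℕ) : IndepFun (fun ω => a * ((√(n k))⁻¹ * ((X k ω : ℝ) - n k * p)))
      (fun ω => b * ((√(m k))⁻¹ * ((Y k ω : ℝ) - m k * p))) P :=
    (hXY k).comp (φ := fun x : ℕ => a * ((√(n k))⁻¹ * ((x : ℝ) - n k * p)))
      (ψ := fun x : ℕ => b * ((√(m k))⁻¹ * ((x : ℝ) - m k * p))) .of_discrete .of_discrete
  have hlim := ((tendsto_charFun_binomial_standardized p hp0 hp1 (a * t)).comp hn).mul
    ((tendsto_charFun_binomial_standardized p hp0 hp1 (b * t)).comp hm)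
  have hv : 0 ≤ (p : ℝ) * (1 - p) * (a ^ 2 + b ^ 2) :=
    mul_nonneg (mul_nonneg hp0.le (by linarith)) (by positivity)
  simp only [ProbabilityMeasure.coe_mk, Measure.map_id, charFun_gaussianReal]
  convert! hlim using 1
  · funext k
    rw [(hind k).charFun_map_fun_add_eq_mul ((hXm k).const_mul a) ((hYm k).const_mul b)]
    simp only [Pi.mul_apply]
    rw [charFun_map_mul_comp (hXm k), charFun_map_mul_comp (hYm k),
      charFun_map_affine_of_hasLaw_binomial (hX k), charFun_map_affine_of_hasLaw_binomial (hY k)]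
    rfl
  · rw [← Complex.exp_add]
    congr 2
    have h1 : ((Real.toNNReal (p * (1 - p) * (a ^ 2 + b ^ 2)) : ℝ) : ℂ) =
        p * (1 - p) * (a ^ 2 + b ^ 2) := by
      rw [Real.coe_toNNReal _ hv]
      push_cast
      ring
    rw [h1]
    push_cast
    ring

end CommonSpace

/-! ### Linearization of the ratio -/

lemma hasFDerivAt_rpow_div_rpow_one (r s : ℝ) :
    HasFDerivAt (fun z : ℝ × ℝ => z.1 ^ s / z.2 ^ r)
      (s • ContinuousLinearMap.fst ℝ ℝ ℝ - r • ContinuousLinearMap.snd ℝ ℝ ℝ) (1, 1) := by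
  have h1 : HasFDerivAt (fun z : ℝ × ℝ => z.1 ^ s)
      ((s * (1 : ℝ) ^ (s - 1)) • ContinuousLinearMap.fst ℝ ℝ ℝ) (1, 1) :=
    (hasFDerivAt_fst (p := ((1 : ℝ), (1 : ℝ)))).rpow_const (Or.inl one_ne_zero)
  have h2 : HasFDerivAt (fun z : ℝ × ℝ => z.2 ^ (-r))
      ((-r * (1 : ℝ) ^ (-r - 1)) • ContinuousLinearMap.snd ℝ ℝ ℝ) (1, 1) :=
    (hasFDerivAt_snd (p := ((1 : ℝ), (1 : ℝ)))).rpow_const (Or.inl one_ne_zero)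
  have h := (h1.mul h2).congr_of_eventuallyEq (f₁ := fun z : ℝ × ℝ => z.1 ^ s / z.2 ^ r) ?_
  · refine h.congr_fderiv ?_
    ext <;> simp
  · have hpos : ∀ᶠ z : ℝ × ℝ in 𝓝 (1, 1), 0 < z.2 :=
      (continuous_snd.tendsto ((1 : ℝ), (1 : ℝ))).eventually_const_lt one_pos
    filter_upwards [hpos] with z hz
    simp [Real.rpow_neg hz.le, div_eq_mul_inv]

lemma binomRatio_eq_centre_mul {r s p : ℝ} (hp : 0 < p) {n m : ℕ} (hn : 0 < n) (x y : ℕ) :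
    binomRatio r s x y = binomRatioCentre r s p n m *
      ((x / (n * p) : ℝ) ^ s / ((x + y) / ((n + m) * p) : ℝ) ^ r) := by
  have hn' : (0 : ℝ) < n := by exact_mod_cast hn
  have hnm : (0 : ℝ) < n + m := by positivity
  unfold binomRatio binomRatioCentre
  rw [Real.div_rpow (by positivity) (by positivity), Real.div_rpow (by positivity) (by positivity),
    Real.mul_rpow hn'.le hp.le, Real.mul_rpow hnm.le hp.le, Real.rpow_sub hp]
  have := Real.rpow_pos_of_pos hn' s
  have := Real.rpow_pos_of_pos hnm r
  have := Real.rpow_pos_of_pos hp r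
  have := Real.rpow_pos_of_pos hp s
  field_simp

lemma aemeasurable_nat_comp₂ {Ω : Type*} [MeasurableSpace Ω] {P : Measure Ω}
    {X Y : Ω → ℕ} (hX : AEMeasurable X P) (hY : AEMeasurable Y P) (g : ℕ → ℕ → ℝ) :
    AEMeasurable (fun ω => g (X ω) (Y ω)) P :=
  (Measurable.of_discrete (f := Function.uncurry g)).comp_aemeasurable (hX.prodMk hY)

section Limit

open scoped unitInterval

lemma tendsto_sqrt_mul_sqrt_div_add {n m : ℕ → ℕ} (hn : Tendsto n atTop atTop) {θ : ℝ}
    (hθ : Tendsto (fun k => (n k : ℝ) / (n k + m k)) atTop (𝓝 θ)) :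
    Tendsto (fun k => √(n k) * √(m k) / (n k + m k : ℝ)) atTop (𝓝 (√(θ * (1 - θ)))) := by
  refine ((hθ.mul (hθ.const_sub 1)).sqrt).congr' ?_
  filter_upwards [hn.eventually_gt_atTop 0] with k hk
  have hk' : (0 : ℝ) < n k := by exact_mod_cast hk
  have hpos : (0 : ℝ) < n k + m k := by positivity
  have h : (n k : ℝ) / (n k + m k) * (1 - n k / (n k + m k)) = n k * m k / (n k + m k) ^ 2 := by
    field_simp
    ring
  rw [h, Real.sqrt_div' _ (by positivity), Real.sqrt_sq hpos.le, Real.sqrt_mul hk'.le]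

/-- The limit theorem for the ratio when all the variables live on one probability space. -/
lemma tendstoInDistribution_binomRatio_common_space {Ω : Type*} [MeasurableSpace Ω]
    {P : Measure Ω} [IsProbabilityMeasure P] (r s : ℝ) {p : I} (hp0 : 0 < (p : ℝ))
    (hp1 : (p : ℝ) < 1) {n m : ℕ → ℕ} (hn : Tendsto n atTop atTop) (hm : Tendsto m atTop atTop)
    {X Y : ℕ → Ω → ℕ}
    (hX : ∀ k, HasLaw (X k) (binomial (n k) p) P) (hY : ∀ k, HasLaw (Y k) (binomial (m k) p) P)
    (hXY : ∀ k, IndepFun (X k) (Y k) P) {θ c : ℝ} {D : ℕ → ℝ}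
    (hθ : Tendsto (fun k => (n k : ℝ) / (n k + m k)) atTop (𝓝 θ))
    (hc : Tendsto (fun k => D k * binomRatioCentre r s p (n k) (m k) / (p * √(n k)))
      atTop (𝓝 c)) :
    TendstoInDistribution
      (fun k ω => D k * (binomRatio r s (X k ω) (Y k ω) - binomRatioCentre r s p (n k) (m k)))
      atTop (id : ℝ → ℝ) (fun _ => P)
      (gaussianReal 0 (Real.toNNReal (p * (1 - p) *
        ((c * (s - r * θ)) ^ 2 + (c * (-r * √(θ * (1 - θ)))) ^ 2)))) := by
  have hw := tendsto_sqrt_mul_sqrt_div_add hn hθ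
  set q : ℕ → ℝ := fun k => (n k : ℝ) / (n k + m k)
  set w : ℕ → ℝ := fun k => √(n k) * √(m k) / (n k + m k : ℝ)
  set c' : ℕ → ℝ := fun k => D k * binomRatioCentre r s p (n k) (m k) / (p * √(n k))
  set a : ℝ := c * (s - r * θ)
  set b : ℝ := c * (-r * √(θ * (1 - θ)))
  set U : ℕ → Ω → ℝ := fun k ω => (√(n k))⁻¹ * ((X k ω : ℝ) - n k * p)
  set V : ℕ → Ω → ℝ := fun k ω => (√(m k))⁻¹ * ((Y k ω : ℝ) - m k * p)
  have hU : BoundedInProbability P U := boundedInProbability_binomial_standardized hX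
  have hV : BoundedInProbability P V := boundedInProbability_binomial_standardized hY
  set f' : ℝ × ℝ →L[ℝ] ℝ := s • ContinuousLinearMap.fst ℝ ℝ ℝ - r • ContinuousLinearMap.snd ℝ ℝ ℝ
  set ρ : ℕ → ℝ := fun k => p * √(n k)
  set v : ℕ → Ω → ℝ × ℝ := fun k ω =>
    (X k ω / (n k * p) - 1, (X k ω + Y k ω) / ((n k + m k) * p) - 1)
  have hρ : Tendsto ρ atTop atTop :=
    ((Real.tendsto_sqrt_atTop.comp (tendsto_natCast_atTop_atTop.comp hn)).const_mul_atTop hp0)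
  -- The second identity rests on `X + Y - (n+m)p = √n U + √m V`.
  have hv : ∀ᶠ k in atTop, ∀ ω, ρ k * (v k ω).1 = U k ω ∧
      ρ k * (v k ω).2 = q k * U k ω + w k * V k ω := by
    filter_upwards [hn.eventually_gt_atTop 0, hm.eventually_gt_atTop 0] with k hnk hmk ω
    have h1 : (0 : ℝ) < √(n k) := Real.sqrt_pos.2 (by exact_mod_cast hnk)
    have h2 : (0 : ℝ) < √(m k) := Real.sqrt_pos.2 (by exact_mod_cast hmk)
    have h3 : (n k : ℝ) = √(n k) ^ 2 := (Real.sq_sqrt (Nat.cast_nonneg _)).symm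
    have h4 : (m k : ℝ) = √(m k) ^ 2 := (Real.sq_sqrt (Nat.cast_nonneg _)).symm
    simp only [ρ, v, U, V, q, w]
    generalize √(n k : ℝ) = N at *
    generalize √(m k : ℝ) = M at *
    rw [h3, h4]
    have h5 : 0 < N ^ 2 + M ^ 2 := by positivity
    constructor
    · field_simp
    · field_simp
      ring
  have hqw : ∀ᶠ k in atTop, 0 ≤ q k ∧ q k ≤ 1 ∧ 0 ≤ w k ∧ w k ≤ 1 := by
    filter_upwards [hn.eventually_gt_atTop 0] with k hnk
    have h0 : (0 : ℝ) < n k := by exact_mod_cast hnk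
    have h1 : (0 : ℝ) < n k + m k := by positivity
    refine ⟨by positivity, ?_, by positivity, ?_⟩
    · rw [div_le_one h1]
      linarith [(Nat.cast_nonneg (m k) : (0 : ℝ) ≤ m k)]
    · rw [div_le_one h1]
      nlinarith [sq_nonneg (√(n k : ℝ) - √(m k : ℝ)), Real.sq_sqrt h0.le,
        Real.sq_sqrt (Nat.cast_nonneg (m k) : (0 : ℝ) ≤ m k), h1]
  have hvT : ∀ᶠ k in atTop, ∀ ω, ρ k * ‖v k ω‖ ≤ |(|U k ω| + |V k ω|)| := by
    filter_upwards [hv, hqw, hρ.eventually_gt_atTop 0] with k h1 ⟨h2, h3, h4, h5⟩ h6 ω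
    rw [Prod.norm_def, mul_max_of_nonneg _ _ h6.le, Real.norm_eq_abs, Real.norm_eq_abs,
      abs_of_nonneg (a := |U k ω| + |V k ω|) (by positivity)]
    have h7 (y : ℝ) : ρ k * |y| = |ρ k * y| := by rw [abs_mul, abs_of_pos h6]
    rw [h7, h7, (h1 ω).1, (h1 ω).2]
    refine max_le (by linarith [abs_nonneg (V k ω)]) ((abs_add_le _ _).trans ?_)
    rw [abs_mul (q k), abs_mul (w k), abs_of_nonneg h2, abs_of_nonneg h4]
    exact add_le_add (mul_le_of_le_one_left (abs_nonneg _) h3)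
      (mul_le_of_le_one_left (abs_nonneg _) h5)
  have hrem := tendstoInMeasure_zero_mul_of_tendsto hc
    ((hU.abs_add_abs hV).tendstoInMeasure_linearization_error (hasFDerivAt_rpow_div_rpow_one r s)
      hρ hvT)
  have hUerr : TendstoInMeasure P (fun k ω => (c' k * (s - r * q k) - a) * U k ω) atTop 0 := by
    refine hU.tendstoInMeasure_zero (c := fun k => c' k * (s - r * q k) - a) ?_
      (Eventually.of_forall fun k ω => (abs_mul _ _).le)
    have := (hc.mul ((hθ.const_mul r).const_sub s)).sub_const a
    rwa [sub_self] at this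
  have hVerr : TendstoInMeasure P (fun k ω => (c' k * (-r * w k) - b) * V k ω) atTop 0 := by
    refine hV.tendstoInMeasure_zero (c := fun k => c' k * (-r * w k) - b) ?_
      (Eventually.of_forall fun k ω => (abs_mul _ _).le)
    have := (hc.mul (hw.const_mul (-r))).sub_const b
    rwa [sub_self] at this
  -- Slutsky error: the Taylor remainder plus the cost of replacing the coefficients of `U` and `V`
  -- by `a` and `b`.
  have herr := tendstoInMeasure_zero_add hrem (tendstoInMeasure_zero_add hUerr hVerr)
  refine tendstoInDistribution_of_tendstoInMeasure_sub _ _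
    (tendstoInDistribution_linear_combination_binomial hn hm hp0 hp1 hX hY hXY a b) ?_ fun k => ?_
  · refine herr.congr' ?_ EventuallyEq.rfl
    filter_upwards [hv, hn.eventually_gt_atTop 0, hρ.eventually_gt_atTop 0] with k h1 hnk h2
    refine Eventually.of_forall fun ω => ?_
    have h3 : D k * binomRatioCentre r s p (n k) (m k) = c' k * ρ k := by
      simp only [c']
      exact (div_mul_cancel₀ _ h2.ne').symm
    have h4 : ((1 : ℝ), (1 : ℝ)) + v k ω =
        ((X k ω / (n k * p) : ℝ), ((X k ω + Y k ω) / ((n k + m k) * p) : ℝ)) := by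
      simp [v]
    have h5 : ρ k * f' (v k ω) = s * U k ω - r * (q k * U k ω + w k * V k ω) := by
      rw [← (h1 ω).2, ← (h1 ω).1]
      simp [f']
      ring
    simp only [Pi.sub_apply]
    rw [binomRatio_eq_centre_mul hp0 hnk (X k ω) (Y k ω), h4]
    have h6 : D k * (binomRatioCentre r s p (n k) (m k) *
        ((X k ω / (n k * p) : ℝ) ^ s / ((X k ω + Y k ω) / ((n k + m k) * p) : ℝ) ^ r) -
          binomRatioCentre r s p (n k) (m k)) = D k * binomRatioCentre r s p (n k) (m k) *
        ((X k ω / (n k * p) : ℝ) ^ s / ((X k ω + Y k ω) / ((n k + m k) * p) : ℝ) ^ r - 1) := by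
      ring
    rw [h6, h3]
    simp only [Real.one_rpow, div_one]
    linear_combination (-c' k) * h5
  · exact ((aemeasurable_nat_comp₂ (hX k).aemeasurable (hY k).aemeasurable
      (binomRatio r s)).sub_const _).const_mul _

/-- The limit theorem for the ratio, in terms of the limit `θ` of the proportion `n / (n + m)` and
of an asymptotically normalizing sequence `D`. -/
theorem tendstoInDistribution_binomRatio (r s : ℝ) {p : I} (hp0 : 0 < (p : ℝ))
    (hp1 : (p : ℝ) < 1) {n m : ℕ → ℕ} (hn : Tendsto n atTop atTop) (hm : Tendsto m atTop atTop)
    {Ω : ℕ → Type*} [mΩ : ∀ k, MeasurableSpace (Ω k)]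
    {P : (k : ℕ) → Measure (Ω k)} [∀ k, IsProbabilityMeasure (P k)]
    {X Y : (k : ℕ) → Ω k → ℕ}
    (hX : ∀ k, HasLaw (X k) (binomial (n k) p) (P k))
    (hY : ∀ k, HasLaw (Y k) (binomial (m k) p) (P k))
    (hXY : ∀ k, IndepFun (X k) (Y k) (P k)) {θ c σ2 : ℝ} {D : ℕ → ℝ}
    (hθ : Tendsto (fun k => (n k : ℝ) / (n k + m k)) atTop (𝓝 θ)) (hθ0 : 0 ≤ θ) (hθ1 : θ ≤ 1)
    (hc : Tendsto (fun k => D k * ((n k : ℝ) ^ s / (n k + m k : ℝ) ^ r) / √(n k)) atTop (𝓝 c))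
    (hvar : σ2 = (p : ℝ) ^ (2 * (s - r) - 1) * (1 - p) *
      (c ^ 2 * ((s - r * θ) ^ 2 + r ^ 2 * (θ * (1 - θ))))) :
    TendstoInDistribution
      (fun k ω => D k * (binomRatio r s (X k ω) (Y k ω) - binomRatioCentre r s p (n k) (m k)))
      atTop (id : ℝ → ℝ) P (gaussianReal 0 (Real.toNNReal σ2)) := by
  have heval (k : ℕ) := measurePreserving_eval_infinitePi P k
  have hc' : Tendsto (fun k => D k * binomRatioCentre r s p (n k) (m k) / (p * √(n k)))
      atTop (𝓝 (c * ((p : ℝ) ^ (s - r) / p))) := by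
    refine (hc.mul_const ((p : ℝ) ^ (s - r) / p)).congr fun k => ?_
    unfold binomRatioCentre
    ring
  have hlaw := tendstoInDistribution_binomRatio_common_space (P := Measure.infinitePi P) r s
    hp0 hp1 hn hm (X := fun k ω => X k (ω k)) (Y := fun k ω => Y k (ω k))
    (fun k => (hX k).comp (heval k).hasLaw) (fun k => (hY k).comp (heval k).hasLaw)
    (fun k => ?_) hθ hc'
  · have hσ : (p : ℝ) * (1 - p) * ((c * ((p : ℝ) ^ (s - r) / p) * (s - r * θ)) ^ 2 +
        (c * ((p : ℝ) ^ (s - r) / p) * (-r * √(θ * (1 - θ)))) ^ 2) = σ2 := by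
      have h1 : (p : ℝ) ^ (2 * (s - r) - 1) = ((p : ℝ) ^ (s - r)) ^ 2 / p := by
        rw [Real.rpow_sub_one hp0.ne', mul_comm, Real.rpow_mul hp0.le, Real.rpow_two]
      have h2 : √(θ * (1 - θ)) ^ 2 = θ * (1 - θ) :=
        Real.sq_sqrt (mul_nonneg hθ0 (by linarith))
      rw [hvar, h1]
      field_simp
      rw [h2]
      ring
    rw [hσ] at hlaw
    refine tendstoInDistribution_of_comp_eval (Z := fun k ω =>
      D k * (binomRatio r s (X k ω) (Y k ω) - binomRatioCentre r s p (n k) (m k)))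
      (fun k => ?_) hlaw
    exact ((aemeasurable_nat_comp₂ (hX k).aemeasurable (hY k).aemeasurable
      (binomRatio r s)).sub_const _).const_mul _
  -- Independence is a property of the joint law, which the measure-preserving evaluation map
  -- carries to the product space.
  · have hprod := (indepFun_iff_hasLaw_prodMk_prod (hX k) (hY k)).1 (hXY k)
    exact (indepFun_iff_hasLaw_prodMk_prod ((hX k).comp (heval k).hasLaw)
      ((hY k).comp (heval k).hasLaw)).2 (hprod.comp (heval k).hasLaw)

end Limit

/-! ### The three regimes -/

lemma rpow_mul_rpow_div_rpow_div_sqrt {r s a b : ℝ} (ha : 0 < a) (hb : 0 < b) :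
    a ^ (r - s + 1 / 2) * (a ^ s / b ^ r) / √a = (a / b) ^ r := by
  rw [Real.sqrt_eq_rpow, Real.div_rpow ha.le hb.le, Real.rpow_add ha, Real.rpow_sub ha]
  have := Real.rpow_pos_of_pos ha s
  have := Real.rpow_pos_of_pos ha (1 / 2)
  have := Real.rpow_pos_of_pos hb r
  field_simp

lemma tendsto_div_add_of_tendsto_div {ι : Type*} {l : Filter ι} {x y : ι → ℝ} {α : ℝ}
    (hα : 0 ≤ α) (hx : ∀ᶠ k in l, 0 < x k) (h : Tendsto (fun k => y k / x k) l (𝓝 α)) :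
    Tendsto (fun k => x k / (x k + y k)) l (𝓝 (1 + α)⁻¹) := by
  refine ((h.const_add 1).inv₀ (by positivity)).congr' ?_
  filter_upwards [hx] with k hk
  rw [← div_self hk.ne', ← add_div, inv_div]

theorem theorem1 (r s : ℝ) (hr : 0 < r) (hs : 0 < s)
    (p : unitInterval) (hp0 : 0 < (p : ℝ)) (hp1 : (p : ℝ) < 1)
    (n m : ℕ → ℕ) (hn : Tendsto n atTop atTop) (hm : Tendsto m atTop atTop)
    {Ω : ℕ → Type*} [mΩ : ∀ k, MeasurableSpace (Ω k)]
    (P : (k : ℕ) → Measure (Ω k)) [∀ k, IsProbabilityMeasure (P k)]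
    (X Y : (k : ℕ) → Ω k → ℕ)
    (hX : ∀ k, HasLaw (X k) (binomial (n k) p) (P k))
    (hY : ∀ k, HasLaw (Y k) (binomial (m k) p) (P k))
    (hXY : ∀ k, IndepFun (X k) (Y k) (P k)) :
    (Tendsto (fun k => (m k : ℝ) / (n k : ℝ)) atTop atTop →
      Tendsto (fun k => (m k : ℝ) * Real.log (m k) * (n k : ℝ) ^ (-(3 / 2) : ℝ)) atTop (𝓝 0) →
      TendstoInDistribution
        (fun k ω => (m k : ℝ) ^ r / (n k : ℝ) ^ (s - 1 / 2) *
          (binomRatio r s (X k ω) (Y k ω) - binomRatioCentre r s p (n k) (m k)))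
        atTop (id : ℝ → ℝ) P
        (gaussianReal 0 (Real.toNNReal ((p : ℝ) ^ (2 * (s - r) - 1) * (1 - p) * s ^ 2)))) ∧
    (∀ α : ℝ, 0 < α → Tendsto (fun k => (m k : ℝ) / (n k : ℝ)) atTop (𝓝 α) →
      TendstoInDistribution
        (fun k ω => (n k : ℝ) ^ (r - s + 1 / 2) *
          (binomRatio r s (X k ω) (Y k ω) - binomRatioCentre r s p (n k) (m k)))
        atTop (id : ℝ → ℝ) P
        (gaussianReal 0 (Real.toNNReal ((p : ℝ) ^ (2 * (s - r) - 1) * (1 - p) *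
          (((s * (1 + α) - r) ^ 2 + α * r ^ 2) / (1 + α) ^ (2 * (r + 1))))))) ∧
    (Tendsto (fun k => (m k : ℝ) / (n k : ℝ)) atTop (𝓝 0) →
      TendstoInDistribution
        (fun k ω => (n k : ℝ) ^ (r - s + 1 / 2) *
          (binomRatio r s (X k ω) (Y k ω) - binomRatioCentre r s p (n k) (m k)))
        atTop (id : ℝ → ℝ) P
        (gaussianReal 0 (Real.toNNReal ((p : ℝ) ^ (2 * (s - r) - 1) * (1 - p) *
          (s - r) ^ 2)))) := by

  have hn0 : ∀ᶠ k in atTop, (0 : ℝ) < n k :=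
    (hn.eventually_gt_atTop 0).mono fun k hk => by exact_mod_cast hk
  have hm0 : ∀ᶠ k in atTop, (0 : ℝ) < m k :=
    (hm.eventually_gt_atTop 0).mono fun k hk => by exact_mod_cast hk
  have hscale {θ : ℝ} (hθ : Tendsto (fun k => (n k : ℝ) / (n k + m k)) atTop (𝓝 θ)) :
      Tendsto (fun k => (n k : ℝ) ^ (r - s + 1 / 2) *
        ((n k : ℝ) ^ s / (n k + m k : ℝ) ^ r) / √(n k)) atTop (𝓝 (θ ^ r)) := by
    refine (hθ.rpow_const (Or.inr hr.le)).congr' ?_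
    filter_upwards [hn0] with k hk
    exact (rpow_mul_rpow_div_rpow_div_sqrt hk (by positivity)).symm
  refine ⟨fun hinf _ => ?_, fun α hα hlim => ?_, fun hlim => ?_⟩
  -- Exchange the roles of `n` and `m`: `n/m → 0` gives `m/(m+n) → 1`, hence `θ = 0`.
  · have hmn : Tendsto (fun k => (m k : ℝ) / (m k + n k)) atTop (𝓝 1) := by
      have h := hinf.inv_tendsto_atTop
      have h' : Tendsto (fun k => (n k : ℝ) / m k) atTop (𝓝 0) :=
        h.congr fun k => by simp only [Pi.inv_apply, inv_div]
      simpa using tendsto_div_add_of_tendsto_div le_rfl hm0 h'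
    have hθ : Tendsto (fun k => (n k : ℝ) / (n k + m k)) atTop (𝓝 0) := by
      have h := hmn.const_sub 1
      rw [sub_self] at h
      refine h.congr' ?_
      filter_upwards [hn0] with k hk
      field_simp
      ring
    refine tendstoInDistribution_binomRatio r s hp0 hp1 hn hm hX hY hXY hθ le_rfl zero_le_one
      (c := 1) ?_ (by ring)
    -- With this normalization the scale factor is exactly `(m/(m+n))^r`, so `c = 1`.
    have h := hmn.rpow_const (p := r) (Or.inr hr.le)
    rw [Real.one_rpow] at h
    refine h.congr' ?_
    filter_upwards [hn0, hm0] with k hk hk'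
    rw [Real.sqrt_eq_rpow, Real.div_rpow hk'.le (by positivity), Real.rpow_sub hk,
      add_comm (m k : ℝ)]
    have := Real.rpow_pos_of_pos hk s
    have := Real.rpow_pos_of_pos hk (1 / 2)
    field_simp
  · have hθ := tendsto_div_add_of_tendsto_div hα.le hn0 hlim
    refine tendstoInDistribution_binomRatio r s hp0 hp1 hn hm hX hY hXY hθ (by positivity)
      (inv_le_one_of_one_le₀ (by linarith)) (hscale hθ) ?_
    have h1 : 0 < 1 + α := by positivity
    have h2 : (1 + α) ^ (2 * (r + 1)) = ((1 + α) ^ r) ^ 2 * (1 + α) ^ 2 := by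
      rw [mul_comm, Real.rpow_mul h1.le, Real.rpow_two, Real.rpow_add_one h1.ne', mul_pow]
    have h3 := Real.rpow_pos_of_pos h1 r
    rw [h2, Real.inv_rpow h1.le]
    congr 1
    field_simp
    ring
  · have hθ := tendsto_div_add_of_tendsto_div le_rfl hn0 hlim
    rw [add_zero, inv_one] at hθ
    refine tendstoInDistribution_binomRatio r s hp0 hp1 hn hm hX hY hXY hθ zero_le_one le_rfl
      (hscale hθ) ?_
    rw [Real.one_rpow]
    ring
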